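/- Regard a poset as a category with a unique arrow $I\to J$ iff $I\le J$. For a category $\mathsf I$, let $\pi_1(\mathsf I)$ be the groupoid freely generated by the category $\mathsf I$; $\mathsf I$ is *simply-connected* if $\pi_1(\mathsf I)$ has at most one morphism between any two objects. An *inverse category* is a category in which every morphism $f:X\to Y$ has a unique pseudoinverse, i.e. a unique $f^{-1}:Y\to X$ with $f\circ f^{-1}\circ f=f$ and $f^{-1}\circ f\circ f^{-1}=f^{-1}$. Let $\mathcal L(\mathsf I)$ be the inverse category freely generated by $\mathsf I$ subject to every morphism $i:I\to J$ of $\mathsf I$ becoming monic, i.e. $i^{-1}\circ i=1_I$ in $\mathcal L(\mathsf I)$; $\mathsf I$ is *upward-simply-connected* if every endomorphism $f$ in $\mathcal L(\mathsf I)$ is idempotent, $f\circ f=f$. A poset is *connected* if it is nonempty and any two of its elements are joined by a zigzag of comparable elements. The class of *finite tree-like* posets is defined inductively (up to isomorphism) by one rule: if $n\ge 0$, $\mathsf K_1,\dots,\mathsf K_n$ are finite tree-like posets and $\mathsf U_k\subseteq\mathsf K_k$ is a connected upward-closed subset for each $k$, then the poset obtained from the disjoint union of the $\mathsf K_k$ (elements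 of different $\mathsf K_k$ being incomparable) by adjoining a single new point lying below exactly itself and the elements of the $\mathsf U_k$, and above no other element, is tree-like. A finite poset is *forest-like* if it is isomorphic to a disjoint union of finitely many (possibly zero) finite tree-like posets. **Corollary.** For a finite poset $\mathsf I$, the following are equivalent: 1. $\mathsf I$ is upward-simply-connected; 2. every upward-closed subset $\mathsf J\subseteq\mathsf I$ (with the induced order) is simply-connected; 3. $\mathsf I$ is forest-like. -/

import Mathlib

open CategoryTheory

universe v u

/-! ## Simply-connected categories -/

/-- A category is simply-connected if its fundamental groupoid (the groupoid freely generated by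
the category) has at most one morphism between any two objects. -/
def IsSimplyConnectedCat (C : Type u) [Category.{v} C] : Prop :=
  ∀ X Y : FreeGroupoid C, Subsingleton (X ⟶ Y)

/-! ## The left fundamental inverse category -/

/-- Formal expressions in the arrows of `C`, built by composition (written in diagrammatic order)
and formal pseudoinverse. -/
inductive InvTerm (C : Type u) [Category.{v} C] : C → C → Type (max u v)
  | of {X Y : C} (f : X ⟶ Y) : InvTerm C X Y
  | comp {X Y Z : C} (s : InvTerm C X Y) (t : InvTerm C Y Z) : InvTerm C X Z
  | inv {X Y : C} (t : InvTerm C X Y) : InvTerm C Y X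

namespace InvTerm

variable {C : Type u} [Category.{v} C]

/-- The congruence on formal expressions generated by
* the category axioms and the relations of `C` (`assoc`, `id_comp`, `comp_id`, `of_comp`);
* the equational axioms of inverse categories: `(t⁻¹)⁻¹ = t`, `t ∘ t⁻¹ ∘ t = t`, and the
  idempotents `s⁻¹ ∘ s` and `t⁻¹ ∘ t` commute (`inv_inv`, `regular`, `comm`);
* the relation `f⁻¹ ∘ f = 1` for each arrow `f` of `C`, which says that `f` becomes monic. -/
inductive Rel : ∀ {X Y : C}, InvTerm C X Y → InvTerm C X Y → Prop
  | refl {X Y : C} (t : InvTerm C X Y) : Rel t t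
  | symm {X Y : C} {s t : InvTerm C X Y} : Rel s t → Rel t s
  | trans {X Y : C} {s t r : InvTerm C X Y} : Rel s t → Rel t r → Rel s r
  | comp_congr {X Y Z : C} {s s' : InvTerm C X Y} {t t' : InvTerm C Y Z} :
      Rel s s' → Rel t t' → Rel (s.comp t) (s'.comp t')
  | inv_congr {X Y : C} {t t' : InvTerm C X Y} : Rel t t' → Rel t.inv t'.inv
  | assoc {W X Y Z : C} (r : InvTerm C W X) (s : InvTerm C X Y) (t : InvTerm C Y Z) :
      Rel ((r.comp s).comp t) (r.comp (s.comp t))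
  | id_comp {X Y : C} (t : InvTerm C X Y) : Rel ((of (𝟙 X)).comp t) t
  | comp_id {X Y : C} (t : InvTerm C X Y) : Rel (t.comp (of (𝟙 Y))) t
  | of_comp {X Y Z : C} (f : X ⟶ Y) (g : Y ⟶ Z) : Rel (of (f ≫ g)) ((of f).comp (of g))
  | inv_inv {X Y : C} (t : InvTerm C X Y) : Rel t.inv.inv t
  | regular {X Y : C} (t : InvTerm C X Y) : Rel ((t.comp t.inv).comp t) t
  | comm {X Y Z : C} (s : InvTerm C X Y) (t : InvTerm C X Z) :
      Rel ((s.comp s.inv).comp (t.comp t.inv)) ((t.comp t.inv).comp (s.comp s.inv))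
  | monic {X Y : C} (f : X ⟶ Y) : Rel ((of f).comp (of f).inv) (of (𝟙 X))

/-- The congruence `InvTerm.Rel` as a setoid. -/
def setoid (X Y : C) : Setoid (InvTerm C X Y) :=
  ⟨Rel, Rel.refl, Rel.symm, Rel.trans⟩

end InvTerm

/-- The left fundamental inverse category of `C`: the inverse category freely generated by `C`
subject to every arrow of `C` becoming monic. It has the same objects as `C`, and its morphisms
are formal expressions modulo `InvTerm.Rel`. -/
structure LeftFundamental (C : Type u) where
  /-- The underlying object of `C`. -/
  as : C

instance (C : Type u) [Category.{v} C] : Category.{max u v} (LeftFundamental C) where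
  Hom X Y := _root_.Quotient (InvTerm.setoid X.as Y.as)
  id X := _root_.Quotient.mk _ (InvTerm.of (𝟙 X.as))
  comp f g := _root_.Quotient.map₂ InvTerm.comp
    (fun _ _ h _ _ h' => InvTerm.Rel.comp_congr h h') f g
  id_comp f := _root_.Quotient.inductionOn f fun t => _root_.Quotient.sound (InvTerm.Rel.id_comp t)
  comp_id f := _root_.Quotient.inductionOn f fun t => _root_.Quotient.sound (InvTerm.Rel.comp_id t)
  assoc f g h := _root_.Quotient.inductionOn₃ f g h fun r s t => _root_.Quotient.sound (InvTerm.Rel.assoc r s t)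

/-- A category is idempotent if all of its endomorphisms are idempotent. -/
def IsIdempotentCat (C : Type u) [Category.{v} C] : Prop :=
  ∀ (X : C) (f : X ⟶ X), f ≫ f = f

/-- A category is upward-simply-connected if its left fundamental inverse category is
idempotent. -/
def IsUpwardSimplyConnected (C : Type u) [Category.{v} C] : Prop :=
  IsIdempotentCat (LeftFundamental C)

/-! ## Tree-like and forest-like posets -/

/-- The set `P` together with one new point. -/
inductive AdjoinBelow (P : Type u) [PartialOrder P] (U : UpperSet P) : Type u
  | pt : AdjoinBelow P U
  | of (x : P) : AdjoinBelow P U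

namespace AdjoinBelow

variable {P : Type u} [PartialOrder P] {U : UpperSet P}

/-- The new point lies below itself and the elements of `U`, and below nothing else; no element
of `P` lies below the new point; the order among the elements of `P` is unchanged. -/
protected def le : AdjoinBelow P U → AdjoinBelow P U → Prop
  | pt, pt => True
  | pt, of x => x ∈ U
  | of _, pt => False
  | of x, of y => x ≤ y

instance : PartialOrder (AdjoinBelow P U) where
  le := AdjoinBelow.le
  le_refl a := by
    cases a with
    | pt => exact trivial
    | of x => exact le_refl x
  le_trans a b c hab hbc := by
    cases a with
    | pt =>
      cases c with
      | pt => exact trivial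
      | of z =>
        cases b with
        | pt => exact hbc
        | of y => exact U.upper hbc hab
    | of x =>
      cases b with
      | pt => exact hab.elim
      | of y =>
        cases c with
        | pt => exact hbc.elim
        | of z => exact le_trans (a := x) hab hbc
  le_antisymm a b hab hba := by
    cases a with
    | pt =>
      cases b with
      | pt => rfl
      | of y => exact hba.elim
    | of x =>
      cases b with
      | pt => exact hab.elim
      | of y => exact congrArg of (le_antisymm (a := x) hab hba)

end AdjoinBelow

/-- The union of upper sets `U k` of posets `K k`, as an upper set of the disjoint union (where
elements of different summands are incomparable). -/
def sigmaUpperSet {n : ℕ} {K : Fin n → Type u} [∀ k, PartialOrder (K k)]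
    (U : ∀ k, UpperSet (K k)) : UpperSet (Σ k, K k) where
  carrier := {x | x.2 ∈ U x.1}
  upper' := by
    rintro _ _ ⟨k, x, y, hxy⟩ hx
    exact (U k).upper hxy hx

/-- Finite tree-like posets, up to isomorphism: given tree-like posets `K k`, finite in number, and
a connected upward-closed subset `U k` of each, adjoin to the disjoint union of the `K k` a single
point lying below each `U k`. Connected includes nonempty; taking no `K k` at all gives the
one-point poset. -/
inductive IsTreeLike : (P : Type u) → [PartialOrder P] → Prop
  | adjoin {n : ℕ} (K : Fin n → Type u) [∀ k, PartialOrder (K k)] (U : ∀ k, UpperSet (K k))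
      (tree : ∀ k, IsTreeLike (K k)) (conn : ∀ k, CategoryTheory.IsConnected ↥(U k))
      (P : Type u) [PartialOrder P] (e : P ≃o AdjoinBelow (Σ k, K k) (sigmaUpperSet U)) :
      IsTreeLike P

/-- A poset is (finite) forest-like if it is a finite disjoint union of tree-like posets. -/
def IsForestLike (P : Type u) [PartialOrder P] : Prop :=
  ∃ (n : ℕ) (K : Fin n → Type u) (_ : ∀ k, PartialOrder (K k)),
    (∀ k, IsTreeLike (K k)) ∧ Nonempty (P ≃o Σ k, K k)

-- The cycle is 1 ⇒ 2 ⇒ 3 ⇒ 1. 1 ⇒ 2 (`IsUpwardSimplyConnected.isSimplyConnectedCat`): for an upper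
-- set J and a base point x₀, sending X to the morphisms x₀ ⟶ X of π₁(J), or to ∅ outside J, is a
-- functor to sets and injections. Hence formal expressions act on it by partial bijections. A loop
-- g at x₀ is realized by an expression acting as right multiplication by g; idempotency gives g ≫ g
-- = g, so g = 1. 2 ⇒ 3 (`IsForestLike.of_remove_minimal`): remove a minimal point p from an upper
-- set; by induction a forest remains. In each of its trees, the part above p must be connected or
-- empty: otherwise a ℤ/2-valued functor marking the arrows from p to one component of that part
-- would detect a nontrivial loop through p. So p joins the trees it touches into one tree. 3 ⇒ 1
-- (`GenIdem.adjoin`): in the natural order of an inverse category, f is idempotent iff f ≤ 1, so it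
-- suffices to bound words from above. When p is adjoined below connected sets, a passage a ← p → b
-- with a, b in the same tree is bounded by a zigzag inside that tree, and an excursion from p back
-- to p is ≤ 1. Every loop is thus bounded by a loop avoiding the new arrows.

universe w

/-! ### Inverse categories and their natural order -/

/-- A category with a pseudoinverse operation satisfying the equational axioms of inverse
categories. -/
class InverseCategory (C : Type u) [Category.{v} C] where
  /-- The pseudoinverse of a morphism. -/
  pinv {X Y : C} (f : X ⟶ Y) : Y ⟶ X
  pinv_pinv {X Y : C} (f : X ⟶ Y) : pinv (pinv f) = f
  regular {X Y : C} (f : X ⟶ Y) : f ≫ pinv f ≫ f = f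
  comm {X Y Z : C} (f : X ⟶ Y) (g : X ⟶ Z) :
    (f ≫ pinv f) ≫ g ≫ pinv g = (g ≫ pinv g) ≫ f ≫ pinv f

namespace InverseCategory

attribute [simp] pinv_pinv regular

variable {C : Type u} [Category.{v} C] {X Y Z : C}

/-- The natural partial order on the morphisms of an inverse category. -/
def Restricts (w v : X ⟶ Y) : Prop := ∃ e : X ⟶ X, e ≫ e = e ∧ w = e ≫ v

theorem Restricts.refl (w : X ⟶ Y) : Restricts w w := ⟨𝟙 X, by simp, by simp⟩

/-- Turns idempotency into an inequality, so that words can be bounded rather than computed. -/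
theorem restricts_id_iff {w : X ⟶ X} : Restricts w (𝟙 X) ↔ w ≫ w = w :=
  ⟨by rintro ⟨e, he, rfl⟩; simpa using he, fun h => ⟨w, h, by simp⟩⟩

variable [InverseCategory C]

@[simp]
theorem regular_assoc (f : X ⟶ Y) (g : Y ⟶ Z) : f ≫ pinv f ≫ f ≫ g = f ≫ g := by
  simpa only [Category.assoc] using congrArg (· ≫ g) (regular f)

@[simp]
theorem pinv_regular (f : X ⟶ Y) : pinv f ≫ f ≫ pinv f = pinv f := by
  simpa using regular (pinv f)

@[simp]
theorem pinv_regular_assoc (f : X ⟶ Y) (g : X ⟶ Z) :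
    pinv f ≫ f ≫ pinv f ≫ g = pinv f ≫ g := by
  simpa only [Category.assoc] using congrArg (· ≫ g) (pinv_regular f)

/-- The axiom `comm` concerns only idempotents of the form `f ≫ pinv f`; this result extends it to
all idempotents. Inserting e = e ≫ e in the middle of `pinv e ≫ e ≫ pinv e` gives two such
projections; commuting them shows that `pinv e` absorbs e on both sides. -/
theorem pinv_eq_self_of_idem {e : X ⟶ X} (he : e ≫ e = e) : pinv e = e := by
  have hc : (e ≫ pinv e) ≫ pinv e ≫ e = (pinv e ≫ e) ≫ e ≫ pinv e := by
    simpa using comm e (pinv e)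
  have h1 : pinv e = (e ≫ pinv e) ≫ pinv e ≫ e := by
    rw [hc]
    calc pinv e = pinv e ≫ e ≫ pinv e := by simp
      _ = pinv e ≫ (e ≫ e) ≫ pinv e := by rw [he]
      _ = _ := by simp
  have he' (W : C) (g : X ⟶ W) : e ≫ e ≫ g = e ≫ g := by
    rw [← Category.assoc, he]
  calc pinv e = (e ≫ pinv e) ≫ pinv e ≫ e := h1
    _ = e ≫ ((e ≫ pinv e) ≫ pinv e ≫ e) ≫ e := by simp [he, he']
    _ = e ≫ pinv e ≫ e := by rw [← h1]
    _ = e := regular e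

theorem idem_comm {e e' : X ⟶ X} (he : e ≫ e = e) (he' : e' ≫ e' = e') : e ≫ e' = e' ≫ e := by
  simpa [pinv_eq_self_of_idem he, pinv_eq_self_of_idem he', he, he'] using comm e e'

theorem idem_comp {e e' : X ⟶ X} (he : e ≫ e = e) (he' : e' ≫ e' = e') :
    (e ≫ e') ≫ e ≫ e' = e ≫ e' := by
  calc (e ≫ e') ≫ e ≫ e' = e ≫ (e' ≫ e) ≫ e' := by simp
    _ = (e ≫ e) ≫ e' ≫ e' := by rw [← idem_comm he he']; simp
    _ = e ≫ e' := by rw [he, he']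

theorem idem_conj (f : X ⟶ Y) {e : Y ⟶ Y} (he : e ≫ e = e) :
    (f ≫ e ≫ pinv f) ≫ f ≫ e ≫ pinv f = f ≫ e ≫ pinv f := by
  have hc : (pinv f ≫ f) ≫ e = e ≫ pinv f ≫ f :=
    idem_comm (by simp) he
  calc (f ≫ e ≫ pinv f) ≫ f ≫ e ≫ pinv f = f ≫ (e ≫ pinv f ≫ f) ≫ e ≫ pinv f := by simp
    _ = f ≫ pinv f ≫ f ≫ (e ≫ e) ≫ pinv f := by rw [← hc]; simp
    _ = f ≫ e ≫ pinv f := by rw [he]; simp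

/-- An idempotent moves from the right of f to its left, which is why the natural order respects
composition and pseudoinverse. -/
theorem comp_idem (f : X ⟶ Y) {e : Y ⟶ Y} (he : e ≫ e = e) :
    f ≫ e = (f ≫ e ≫ pinv f) ≫ f := by
  have hc : (pinv f ≫ f) ≫ e = e ≫ pinv f ≫ f :=
    idem_comm (by simp) he
  calc f ≫ e = f ≫ (pinv f ≫ f) ≫ e := by simp
    _ = _ := by rw [hc]; simp

theorem pinv_unique {f : X ⟶ Y} {g : Y ⟶ X} (h₁ : f ≫ g ≫ f = f) (h₂ : g ≫ f ≫ g = g) :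
    g = pinv f := by
  have hl : (g ≫ f) ≫ pinv f ≫ f = (pinv f ≫ f) ≫ g ≫ f :=
    idem_comm (by simp [h₁]) (by simp)
  have hr : (f ≫ g) ≫ f ≫ pinv f = (f ≫ pinv f) ≫ f ≫ g :=
    idem_comm (by simp [h₂]) (by simp)
  have ha : g ≫ f = pinv f ≫ f := by
    calc g ≫ f = (g ≫ f) ≫ pinv f ≫ f := by simp
      _ = pinv f ≫ f ≫ g ≫ f := by rw [hl]; simp
      _ = pinv f ≫ f := by rw [h₁]
  have hb : f ≫ g = f ≫ pinv f := by
    calc f ≫ g = (f ≫ pinv f) ≫ f ≫ g := by simp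
      _ = (f ≫ g ≫ f) ≫ pinv f := by rw [← hr]; simp
      _ = f ≫ pinv f := by rw [h₁]
  calc g = g ≫ f ≫ g := h₂.symm
    _ = (g ≫ f) ≫ pinv f := by rw [hb]; simp
    _ = pinv f := by rw [ha]; simp

@[simp]
theorem pinv_comp (f : X ⟶ Y) (g : Y ⟶ Z) : pinv (f ≫ g) = pinv g ≫ pinv f := by
  have hc : (pinv f ≫ f) ≫ g ≫ pinv g = (g ≫ pinv g) ≫ pinv f ≫ f :=
    idem_comm (by simp) (by simp)
  refine (pinv_unique ?_ ?_).symm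
  · calc (f ≫ g) ≫ (pinv g ≫ pinv f) ≫ f ≫ g
        = f ≫ ((g ≫ pinv g) ≫ pinv f ≫ f) ≫ g := by simp
      _ = f ≫ g := by rw [← hc]; simp
  · calc (pinv g ≫ pinv f) ≫ (f ≫ g) ≫ pinv g ≫ pinv f
        = pinv g ≫ ((pinv f ≫ f) ≫ g ≫ pinv g) ≫ pinv f := by simp
      _ = pinv g ≫ pinv f := by rw [hc]; simp

namespace Restricts

theorem trans {w v t : X ⟶ Y} : Restricts w v → Restricts v t → Restricts w t := by
  rintro ⟨e, he, rfl⟩ ⟨e', he', rfl⟩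
  exact ⟨e ≫ e', idem_comp he he', by simp⟩

theorem comp {w v : X ⟶ Y} {w' v' : Y ⟶ Z} :
    Restricts w v → Restricts w' v' → Restricts (w ≫ w') (v ≫ v') := by
  rintro ⟨e, he, rfl⟩ ⟨e', he', rfl⟩
  refine ⟨e ≫ v ≫ e' ≫ pinv v, idem_comp he (idem_conj v he'), ?_⟩
  have := congrArg (fun t => e ≫ t ≫ v') (comp_idem v he')
  simpa using this

theorem pinv {w v : X ⟶ Y} : Restricts w v → Restricts (pinv w) (pinv v) := by
  rintro ⟨e, he, rfl⟩
  refine ⟨InverseCategory.pinv v ≫ e ≫ v, ?_, ?_⟩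
  · simpa using idem_conj (InverseCategory.pinv v) he
  · rw [pinv_comp, pinv_eq_self_of_idem he]
    simpa using comp_idem (InverseCategory.pinv v) he

end Restricts

theorem pinv_comp_self_restricts (f : X ⟶ Y) : Restricts (pinv f ≫ f) (𝟙 Y) :=
  restricts_id_iff.2 (by simp)

end InverseCategory

open InverseCategory

/-! ### Words in the images of arrows, and adjoining a point -/

section Generated

variable {I : Type u} [PartialOrder I] {C : Type u} [Category.{v} C] [InverseCategory C]
  (F : I ⥤ C)

/-- The morphisms generated, under composition and pseudoinverse, by the images of the arrows
`x ⟶ y` with `R x y`. -/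
inductive Gen (R : I → I → Prop) : ∀ {x y : I}, (F.obj x ⟶ F.obj y) → Prop
  | map {x y : I} (f : x ⟶ y) (h : R x y) : Gen R (F.map f)
  | pinv {x y : I} {w : F.obj x ⟶ F.obj y} : Gen R w → Gen R (pinv w)
  | comp {x y z : I} {w : F.obj x ⟶ F.obj y} {w' : F.obj y ⟶ F.obj z} :
      Gen R w → Gen R w' → Gen R (w ≫ w')

/-- The relation of belonging to a common set `S`. -/
def Within (S : Set I) (x y : I) : Prop := x ∈ S ∧ y ∈ S

/-- The relation of belonging to a common member of a family of sets. -/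
def WithinSome {κ : Type*} (S : κ → Set I) (x y : I) : Prop := ∃ k, x ∈ S k ∧ y ∈ S k

/-- All endomorphisms generated by the arrows in `R` are idempotent. -/
def GenIdem (R : I → I → Prop) : Prop :=
  ∀ (x : I) (w : F.obj x ⟶ F.obj x), Gen F R w → Restricts w (𝟙 _)

variable {F}

theorem Gen.mono {R R' : I → I → Prop} (hR : ∀ x y, x ≤ y → R x y → R' x y) {x y : I}
    {w : F.obj x ⟶ F.obj y} (h : Gen F R w) : Gen F R' w := by
  induction h with
  | map f h => exact .map f (hR _ _ (leOfHom f) h)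
  | pinv _ ih => exact ih.pinv
  | comp _ _ ih ih' => exact ih.comp ih'

theorem GenIdem.mono {R R' : I → I → Prop} (hR : ∀ x y, x ≤ y → R' x y → R x y)
    (h : GenIdem F R) : GenIdem F R' :=
  fun x w hw => h x w (hw.mono hR)

theorem Gen.id {R : I → I → Prop} {x : I} (h : R x x) : Gen F R (𝟙 (F.obj x)) := by
  rw [← F.map_id]
  exact .map _ h

/-- Consecutive letters share an object, so a word cannot jump between disjoint pieces. -/
theorem Gen.exists_within {κ : Type*} {S : κ → Set I}
    (hS : ∀ k l x, x ∈ S k → x ∈ S l → k = l) {x y : I} {w : F.obj x ⟶ F.obj y}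
    (h : Gen F (WithinSome S) w) : ∃ k, x ∈ S k ∧ y ∈ S k ∧ Gen F (Within (S k)) w := by
  induction h with
  | map f h =>
    obtain ⟨k, hx, hy⟩ := h
    exact ⟨k, hx, hy, .map f ⟨hx, hy⟩⟩
  | pinv _ ih =>
    obtain ⟨k, hx, hy, hw⟩ := ih
    exact ⟨k, hy, hx, hw.pinv⟩
  | comp _ _ ih ih' =>
    obtain ⟨k, hx, hy, hw⟩ := ih
    obtain ⟨l, hy', hz, hw'⟩ := ih'
    obtain rfl := hS _ _ _ hy hy'
    exact ⟨k, hx, hz, hw.comp hw'⟩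

theorem GenIdem.withinSome {κ : Type*} {S : κ → Set I}
    (hS : ∀ k l x, x ∈ S k → x ∈ S l → k = l) (h : ∀ k, GenIdem F (Within (S k))) :
    GenIdem F (WithinSome S) := by
  intro x w hw
  obtain ⟨k, _, _, hk⟩ := hw.exists_within hS
  exact h k x w hk

theorem genIdem_singleton (p : I) : GenIdem F (Within {p}) := by
  -- With varying endpoints, "w is an identity" is expressed as equality with the image of any
  -- arrow.
  have key : ∀ {x y : I} (w : F.obj x ⟶ F.obj y), Gen F (Within {p}) w →
      x = p ∧ y = p ∧ ∀ f : x ⟶ y, w = F.map f := by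
    intro x y w hw
    induction hw with
    | map f h => exact ⟨h.1, h.2, fun g => congrArg F.map (Subsingleton.elim _ _)⟩
    | pinv _ ih =>
      obtain ⟨rfl, rfl, h⟩ := ih
      refine ⟨rfl, rfl, fun f => ?_⟩
      rw [h (𝟙 _), Subsingleton.elim f (𝟙 _), F.map_id]
      exact pinv_eq_self_of_idem (by simp)
    | comp _ _ ih ih' =>
      obtain ⟨rfl, rfl, h⟩ := ih
      obtain ⟨_, rfl, h'⟩ := ih'
      refine ⟨rfl, rfl, fun f => ?_⟩
      rw [h (𝟙 _), h' (𝟙 _), Subsingleton.elim f (𝟙 _)]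
      simp
  intro x w hw
  rw [(key w hw).2.2 (𝟙 _), F.map_id]
  exact .refl _

variable (hF : ∀ {x y : I} (f : x ⟶ y), F.map f ≫ pinv (F.map f) = 𝟙 _)
include hF

/-- Inserting `F.map (p ⟶ b) ≫ pinv (F.map (p ⟶ b)) = 𝟙` at each intermediate b reduces to one step
of the zigzag. There the triangle over p and `pinv f ≫ f ≤ 𝟙` give the bound. -/
theorem exists_gen_of_zigzag {p : I} {T : Set I} {a b : {a // a ∈ T ∧ p ≤ a}} (h : Zigzag a b) :
    ∃ z : F.obj a.1 ⟶ F.obj b.1, Gen F (Within T) z ∧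
      Restricts (pinv (F.map (homOfLE a.2.2)) ≫ F.map (homOfLE b.2.2)) z := by
  induction h with
  | refl => exact ⟨𝟙 _, .id ⟨a.2.1, a.2.1⟩, pinv_comp_self_restricts _⟩
  | @tail b c _ hbc ih =>
    obtain ⟨z, hz, hab⟩ := ih
    have split : pinv (F.map (homOfLE a.2.2)) ≫ F.map (homOfLE c.2.2) =
        (pinv (F.map (homOfLE a.2.2)) ≫ F.map (homOfLE b.2.2)) ≫
          pinv (F.map (homOfLE b.2.2)) ≫ F.map (homOfLE c.2.2) := by
      have := congrArg (fun t => pinv (F.map (homOfLE a.2.2)) ≫ t ≫ F.map (homOfLE c.2.2))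
        (hF (homOfLE b.2.2))
      simpa using this.symm
    rw [split]
    rcases hbc with ⟨⟨f⟩⟩ | ⟨⟨f⟩⟩
    · have f' : b.1 ⟶ c.1 := homOfLE (leOfHom f)
      refine ⟨z ≫ F.map f', hz.comp (.map f' ⟨b.2.1, c.2.1⟩), hab.comp ?_⟩
      rw [← Subsingleton.elim (homOfLE b.2.2 ≫ f') (homOfLE c.2.2), F.map_comp]
      have := (pinv_comp_self_restricts (F.map (homOfLE b.2.2))).comp (.refl (F.map f'))
      simpa using this
    · have f' : c.1 ⟶ b.1 := homOfLE (leOfHom f)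
      refine ⟨z ≫ pinv (F.map f'), hz.comp (.pinv (.map f' ⟨c.2.1, b.2.1⟩)), hab.comp ?_⟩
      rw [← Subsingleton.elim (homOfLE c.2.2 ≫ f') (homOfLE b.2.2), F.map_comp, pinv_comp]
      have := (Restricts.refl (pinv (F.map f'))).comp
        (pinv_comp_self_restricts (F.map (homOfLE c.2.2)))
      simpa using this

/-- Adjoining a point `p` below a preconnected part of each of the disjoint sets `S k`
(one of which consists of `p` itself) preserves idempotency. -/
theorem GenIdem.adjoin {κ : Type*} {S : κ → Set I} (hS : ∀ k l x, x ∈ S k → x ∈ S l → k = l)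
    (h : ∀ k, GenIdem F (Within (S k))) {p : I} (hp : ∃ k, p ∈ S k)
    (hconn : ∀ k, IsPreconnected {a // a ∈ S k ∧ p ≤ a}) :
    GenIdem F (fun x y => WithinSome S x y ∨ (x = p ∧ ∃ k, y ∈ S k)) := by
  have hidem := GenIdem.withinSome hS h
  -- Here v serves only to certify that a and b lie in the same piece.
  have bridge : ∀ {a b : I} (ha : p ⟶ a) (hb : p ⟶ b) (v : F.obj a ⟶ F.obj b),
      Gen F (WithinSome S) v → ∃ z : F.obj a ⟶ F.obj b, Gen F (WithinSome S) z ∧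
        Restricts (pinv (F.map ha) ≫ F.map hb) z := by
    intro a b ha hb v hv
    obtain ⟨k, hak, hbk, -⟩ := hv.exists_within hS
    have := hconn k
    obtain ⟨z, hz, hr⟩ := exists_gen_of_zigzag hF
      (isPreconnected_zigzag (⟨a, hak, leOfHom ha⟩ : {a // a ∈ S k ∧ p ≤ a})
        ⟨b, hbk, leOfHom hb⟩)
    exact ⟨z, hz.mono fun x y _ h => ⟨k, h⟩, hr⟩
  -- An excursion from p to p: bounding the return leg by z followed by the return from a turns `v ≫
  -- z` into a loop inside one piece.
  have loop : ∀ {a b : I} (ha : p ⟶ a) (hb : p ⟶ b) (v : F.obj a ⟶ F.obj b),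
      Gen F (WithinSome S) v → Restricts (F.map ha ≫ v ≫ pinv (F.map hb)) (𝟙 _) := by
    intro a b ha hb v hv
    obtain ⟨z, hz, hr⟩ := bridge hb ha _ hv.pinv
    have h1 : Restricts (pinv (F.map hb)) (z ≫ pinv (F.map ha)) := by
      have := hr.comp (.refl (pinv (F.map ha)))
      simpa [hF] using this
    have h2 : Restricts (v ≫ z) (𝟙 _) := hidem _ _ (hv.comp hz)
    have h3 := (Restricts.refl (F.map ha)).comp ((Restricts.refl v).comp h1)
    have h4 := (Restricts.refl (F.map ha)).comp (h2.comp (.refl (pinv (F.map ha))))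
    simp only [Category.assoc, Category.id_comp, hF] at h4
    exact h3.trans h4
  -- Every word is bounded by one that passes through p at most once in this way; `loop` merges two
  -- passages.
  have key : ∀ {x y : I} (w : F.obj x ⟶ F.obj y),
      Gen F (fun x y => WithinSome S x y ∨ (x = p ∧ ∃ k, y ∈ S k)) w →
      (∃ v, Gen F (WithinSome S) v ∧ Restricts w v) ∨
      ∃ (a b : I) (ha : p ⟶ a) (hb : p ⟶ b) (u : F.obj x ⟶ F.obj a) (v : F.obj b ⟶ F.obj y),
        Gen F (WithinSome S) u ∧ Gen F (WithinSome S) v ∧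
          Restricts w (u ≫ (pinv (F.map ha) ≫ F.map hb) ≫ v) := by
    intro x y w hw
    induction hw with
    | @map x y f h =>
      rcases h with h | ⟨rfl, k, hk⟩
      · exact .inl ⟨_, .map f h, .refl _⟩
      -- An arrow out of p counts as a passage whose incoming leg is the identity of p.
      · obtain ⟨l, hl⟩ := hp
        refine .inr ⟨x, y, 𝟙 x, f, 𝟙 _, 𝟙 _, .id ⟨l, hl, hl⟩, .id ⟨k, hk, hk⟩, ?_⟩
        rw [F.map_id, pinv_eq_self_of_idem (Category.id_comp (𝟙 (F.obj x)))]
        simpa using .refl _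
    | pinv _ ih =>
      rcases ih with ⟨v, hv, hr⟩ | ⟨a, b, ha, hb, u, v, hu, hv, hr⟩
      · exact .inl ⟨_, hv.pinv, hr.pinv⟩
      · exact .inr ⟨b, a, hb, ha, _, _, hv.pinv, hu.pinv, by simpa using hr.pinv⟩
    | comp _ _ ih ih' =>
      rcases ih with ⟨v, hv, hr⟩ | ⟨a, b, ha, hb, u, v, hu, hv, hr⟩ <;>
      rcases ih' with ⟨v', hv', hr'⟩ | ⟨a', b', ha', hb', u', v', hu', hv', hr'⟩
      · exact .inl ⟨_, hv.comp hv', hr.comp hr'⟩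
      · exact .inr ⟨a', b', ha', hb', _, _, hv.comp hu', hv', by simpa using hr.comp hr'⟩
      · exact .inr ⟨a, b, ha, hb, _, _, hu, hv.comp hv', by simpa using hr.comp hr'⟩
      · refine .inr ⟨a, b', ha, hb', u, v', hu, hv', (hr.comp hr').trans ?_⟩
        have := (Restricts.refl (u ≫ pinv (F.map ha))).comp
          ((loop hb ha' _ (hv.comp hu')).comp (.refl (F.map hb' ≫ v')))
        simpa using this
  intro x w hw
  rcases key w hw with ⟨v, hv, hr⟩ | ⟨a, b, ha, hb, u, v, hu, hv, hr⟩
  · exact hr.trans (hidem _ _ hv)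
  -- The word is a loop, so `v ≫ u` joins b to a and the last passage can be bridged.
  · obtain ⟨z, hz, hz'⟩ := bridge ha hb _ (hv.comp hu).pinv
    exact (hr.trans ((Restricts.refl u).comp (hz'.comp (.refl v)))).trans
      (hidem _ _ (hu.comp (hz.comp hv)))

end Generated

open InverseCategory

/-! ### Forest-like posets are upward-simply-connected -/

namespace LeftFundamental

section

variable {C : Type u} [Category.{v} C]

instance : InverseCategory (LeftFundamental C) where
  pinv f := _root_.Quotient.map InvTerm.inv (fun _ _ h => InvTerm.Rel.inv_congr h) f
  pinv_pinv f := _root_.Quotient.inductionOn f fun t =>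
    _root_.Quotient.sound (InvTerm.Rel.inv_inv t)
  regular f := _root_.Quotient.inductionOn f fun t =>
    _root_.Quotient.sound ((InvTerm.Rel.assoc _ _ _).symm.trans (InvTerm.Rel.regular t))
  comm f g := _root_.Quotient.inductionOn₂ f g fun s t =>
    _root_.Quotient.sound (InvTerm.Rel.comm s t)

variable (C) in
/-- The canonical functor to the left fundamental inverse category. -/
def incl : C ⥤ LeftFundamental C where
  obj X := ⟨X⟩
  map f := _root_.Quotient.mk _ (InvTerm.of f)
  map_comp f g := _root_.Quotient.sound (InvTerm.Rel.of_comp f g)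

theorem incl_map_comp_pinv {X Y : C} (f : X ⟶ Y) :
    (incl C).map f ≫ pinv ((incl C).map f) = 𝟙 _ :=
  _root_.Quotient.sound (InvTerm.Rel.monic f)

end

theorem gen_incl {I : Type u} [PartialOrder I] {R : I → I → Prop}
    (hR : ∀ x y, x ≤ y → R x y) {x y : I} (w : (incl I).obj x ⟶ (incl I).obj y) :
    Gen (incl I) R w := by
  have key : ∀ {x y : I} (t : InvTerm I x y),
      Gen (incl I) R (x := x) (y := y) (_root_.Quotient.mk _ t) := by
    intro x y t
    induction t with
    | of f => exact Gen.map (F := incl I) f (hR _ _ (leOfHom f))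
    | comp _ _ ih ih' => exact Gen.comp ih ih'
    | inv _ ih => exact Gen.pinv ih
  exact _root_.Quotient.inductionOn w key

end LeftFundamental

section Forest

variable {I : Type u} [PartialOrder I] {C : Type u} [Category.{v} C] [InverseCategory C]
  {F : I ⥤ C} (hF : ∀ {x y : I} (f : x ⟶ y), F.map f ≫ pinv (F.map f) = 𝟙 _)
include hF

/-- Quantifying over embeddings into a fixed I lets the induction hypothesis apply to each subtree
with the same functor F. -/
theorem IsTreeLike.genIdem_range {P : Type u} [PartialOrder P] (hP : IsTreeLike P)
    (φ : P ↪o I) : GenIdem F (Within (Set.range φ)) := by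
  induction hP with
  | @adjoin n K _ U _ conn P _ e ih =>
    have of_le : ∀ {s t : Σ k, K k},
        (AdjoinBelow.of s : AdjoinBelow _ (sigmaUpperSet U)) ≤ .of t ↔ s ≤ t := Iff.rfl
    let ψ (k : Fin n) : K k ↪o I := OrderEmbedding.ofMapLEIff
      (fun x => φ (e.symm (.of ⟨k, x⟩))) fun x y => by
        simp [of_le]
    let p : I := φ (e.symm .pt)
    -- The piece `none` is the new point alone.
    let S : Option (Fin n) → Set I := fun o => o.elim {p} fun k => Set.range (ψ k)
    have hS : ∀ k l x, x ∈ S k → x ∈ S l → k = l := by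
      rintro (_ | k) (_ | l) x hk hl
      · rfl
      · obtain rfl : x = p := hk
        obtain ⟨y, hy⟩ := hl
        have := e.symm.injective (φ.injective hy)
        cases this
      · obtain rfl : x = p := hl
        obtain ⟨y, hy⟩ := hk
        have := e.symm.injective (φ.injective hy)
        cases this
      · obtain ⟨y, rfl⟩ := hk
        obtain ⟨z, hz⟩ := hl
        have := e.symm.injective (φ.injective hz)
        cases this
        rfl
    have hidem : ∀ k, GenIdem F (Within (S k)) := by
      rintro (_ | k)
      · exact genIdem_singleton p
      · exact ih k (ψ k)
    have hconn : ∀ k, IsPreconnected {a // a ∈ S k ∧ p ≤ a} := by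
      rintro (_ | k)
      · have : Subsingleton {a // a ∈ S none ∧ p ≤ a} :=
          ⟨fun a b => Subtype.ext ((show a.1 = p from a.2.1).trans (show b.1 = p from b.2.1).symm)⟩
        refine zigzag_isPreconnected fun a b => ?_
        rw [Subsingleton.elim a b]
      · have hmem : ∀ x : K k, p ≤ ψ k x ↔ x ∈ U k := fun x => by
          change φ (e.symm _) ≤ φ (e.symm _) ↔ _
          rw [φ.le_iff_le, e.symm.le_iff_le]
          rfl
        have hmono : Monotone fun x : U k =>
            (⟨ψ k x, ⟨x, rfl⟩, (hmem x).2 x.2⟩ : {a // a ∈ S (some k) ∧ p ≤ a}) :=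
          fun x y hxy => (ψ k).monotone hxy
        have := conn k
        refine zigzag_isPreconnected ?_
        rintro ⟨_, ⟨a, rfl⟩, ha⟩ ⟨_, ⟨b, rfl⟩, hb⟩
        exact zigzag_obj_of_zigzag hmono.functor
          (isPreconnected_zigzag (⟨a, (hmem a).1 ha⟩ : U k) ⟨b, (hmem b).1 hb⟩)
    refine (GenIdem.adjoin hF hS hidem ⟨none, rfl⟩ hconn).mono ?_
    have hrange : ∀ y : P, ∃ k, φ y ∈ S k := by
      intro y
      obtain ⟨_ | ⟨k, y⟩, rfl⟩ := e.symm.surjective y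
      · exact ⟨none, rfl⟩
      · exact ⟨some k, y, rfl⟩
    rintro _ _ hxy ⟨⟨x, rfl⟩, ⟨y, rfl⟩⟩
    obtain ⟨x, rfl⟩ := e.symm.surjective x
    obtain ⟨y, rfl⟩ := e.symm.surjective y
    rw [φ.le_iff_le, e.symm.le_iff_le] at hxy
    rcases x with _ | ⟨k, x⟩
    · exact .inr ⟨rfl, hrange _⟩
    · rcases y with _ | ⟨l, y⟩
      · exact hxy.elim
      · obtain rfl : k = l := (Sigma.le_def.1 (of_le.1 hxy)).fst
        exact .inl ⟨some k, ⟨x, rfl⟩, ⟨y, rfl⟩⟩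

end Forest

theorem IsForestLike.isUpwardSimplyConnected {I : Type u} [PartialOrder I] (h : IsForestLike I) :
    IsUpwardSimplyConnected I := by
  obtain ⟨n, K, _, hK, ⟨e⟩⟩ := h
  let ψ (k : Fin n) : K k ↪o I := OrderEmbedding.ofMapLEIff
    (fun x => e.symm ⟨k, x⟩) fun x y => by simp
  have hS : ∀ k l x, x ∈ Set.range (ψ k) → x ∈ Set.range (ψ l) → k = l := by
    rintro k l _ ⟨x, rfl⟩ ⟨y, hy⟩
    have := e.symm.injective hy
    cases this
    rfl
  have hidem := GenIdem.withinSome hS fun k =>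
    (hK k).genIdem_range LeftFundamental.incl_map_comp_pinv (ψ k)
  intro X f
  refine restricts_id_iff.1 (hidem X.as f (LeftFundamental.gen_incl ?_ _))
  intro x y hxy
  obtain ⟨⟨k, x⟩, rfl⟩ := e.symm.surjective x
  obtain ⟨⟨l, y⟩, rfl⟩ := e.symm.surjective y
  obtain rfl : k = l := (Sigma.le_def.1 (e.symm.le_iff_le.1 hxy)).fst
  exact ⟨k, ⟨x, rfl⟩, ⟨y, rfl⟩⟩

/-! ### Free groupoids, partial bijections and upper sets -/

namespace CategoryTheory.FreeGroupoid

variable {C : Type u} [Category.{v} C]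

/-- A property of morphisms of the free groupoid that is closed under composition holds for all
morphisms as soon as it holds for the generators and their inverses. -/
theorem hom_induction {P : ∀ {X Y : C}, (mk X ⟶ mk Y) → Prop}
    (of : ∀ {X Y : C} (f : X ⟶ Y), P (homMk f))
    (inv : ∀ {X Y : C} (f : X ⟶ Y), P (Groupoid.inv (homMk f)))
    (comp : ∀ {X Y Z : C} (f : mk X ⟶ mk Y) (g : mk Y ⟶ mk Z), P f → P g → P (f ≫ g))
    {X Y : C} (g : mk X ⟶ mk Y) : P g := by
  obtain ⟨g, rfl⟩ := (Quotient.functor (FreeGroupoid.homRel C)).map_surjective g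
  obtain ⟨g, rfl⟩ := (Quotient.functor (Quiver.FreeGroupoid.redStep (V := C))).map_surjective g
  have key : ∀ {Z : Quiver.Symmetrify C} (g : Quiver.Path (V := Quiver.Symmetrify C) X Z),
      P (X := X) (Y := Z) ((Quotient.functor (FreeGroupoid.homRel C)).map
        ((Quotient.functor (Quiver.FreeGroupoid.redStep (V := C))).map g)) := by
    intro Z g
    induction g with
    | nil =>
      have := of (𝟙 X)
      rw [homMk, Functor.map_id] at this
      exact this
    | cons g f ih =>
      rcases f with f | f
      · exact comp _ _ ih (of f)
      · exact comp _ _ ih (inv f)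
  exact key g

end CategoryTheory.FreeGroupoid

namespace PEquiv

variable {α : Type*} {β : Type*} {γ : Type*}

/-- An injective function, as a partial equivalence. -/
noncomputable def ofInjective (f : α → β) (hf : Function.Injective f) : α ≃. β where
  toFun a := some (f a)
  invFun := Function.partialInv f
  inv a b := by
    rw [hf.isPartialInv a b, Option.some_inj]

@[simp]
theorem ofInjective_apply (f : α → β) (hf : Function.Injective f) (a : α) :
    ofInjective f hf a = some (f a) := rfl

theorem trans_symm_self_eq_some {f : α ≃. β} {a a' : α} :
    (f.trans f.symm) a = some a' ↔ a = a' ∧ ∃ b, f a = some b := by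
  simp only [trans_eq_some, eq_some_iff]
  constructor
  · rintro ⟨b, h, h'⟩
    exact ⟨f.inj h h', b, h⟩
  · rintro ⟨rfl, b, h⟩
    exact ⟨b, h, h⟩

theorem trans_symm_trans_self (f : α ≃. β) : (f.trans f.symm).trans f = f := by
  ext a b
  simp only [trans_eq_some (f.trans f.symm), trans_symm_self_eq_some]
  constructor
  · rintro ⟨_, ⟨rfl, -⟩, h⟩
    exact h
  · exact fun h => ⟨a, ⟨rfl, b, h⟩, h⟩

theorem trans_symm_comm (f : α ≃. β) (g : α ≃. γ) :
    (f.trans f.symm).trans (g.trans g.symm) = (g.trans g.symm).trans (f.trans f.symm) := by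
  ext a b
  simp only [trans_eq_some (f.trans f.symm), trans_eq_some (g.trans g.symm),
    trans_symm_self_eq_some]
  constructor <;>
  · rintro ⟨_, ⟨rfl, h⟩, rfl, h'⟩
    exact ⟨_, ⟨rfl, h'⟩, rfl, h⟩

end PEquiv

/-- A functor from `C` to the category of types and injective functions. -/
structure InjectiveAction (C : Type u) [Category.{v} C] where
  /-- The type assigned to an object. -/
  obj : C → Type w
  /-- The function assigned to an arrow. -/
  map {X Y : C} (f : X ⟶ Y) : obj X → obj Y
  map_id (X : C) (a : obj X) : map (𝟙 X) a = a
  map_comp {X Y Z : C} (f : X ⟶ Y) (g : Y ⟶ Z) (a : obj X) : map (f ≫ g) a = map g (map f a)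
  map_injective {X Y : C} (f : X ⟶ Y) : Function.Injective (map f)

namespace InvTerm

variable {C : Type u} [Category.{v} C] (Φ : InjectiveAction.{v, u, w} C)

/-- The action of formal expressions by partial bijections. -/
noncomputable def act : ∀ {X Y : C}, InvTerm C X Y → (Φ.obj X ≃. Φ.obj Y)
  | _, _, of f => PEquiv.ofInjective (Φ.map f) (Φ.map_injective f)
  | _, _, comp s t => (act s).trans (act t)
  | _, _, inv t => (act t).symm

theorem act_of_id (X : C) : act Φ (of (𝟙 X)) = PEquiv.refl _ := by
  ext
  simp [act, Φ.map_id]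

/-- Partial bijections satisfy the inverse category axioms, and totality of the injections `Φ.map f`
yields the relation `monic`. -/
theorem Rel.act_eq {X Y : C} {s t : InvTerm C X Y} (h : Rel s t) : act Φ s = act Φ t := by
  induction h with
  | refl => rfl
  | symm _ ih => exact ih.symm
  | trans _ _ ih ih' => exact ih.trans ih'
  | comp_congr _ _ ih ih' => simp only [act, ih, ih']
  | inv_congr _ ih => simp only [act, ih]
  | assoc => exact PEquiv.trans_assoc _ _ _
  | id_comp => rw [act, act_of_id, PEquiv.refl_trans]
  | comp_id => rw [act, act_of_id, PEquiv.trans_refl]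
  | of_comp f g =>
    ext a b
    simp [act, PEquiv.trans_eq_some, Φ.map_comp]
  | inv_inv => rfl
  | regular => exact PEquiv.trans_symm_trans_self _
  | comm => exact PEquiv.trans_symm_comm _ _
  | monic f =>
    rw [act_of_id]
    ext a b
    simp only [act, PEquiv.trans_symm_self_eq_some]
    simp

end InvTerm

section UpperSet

open FreeGroupoid

variable {I : Type u} [PartialOrder I] {J : Set I} (hJ : IsUpperSet J) (x₀ : J)

/-- The action of `I` sending `X` to the set of morphisms `x₀ ⟶ X` of the fundamental groupoid of
the upward-closed set `J`, where this set is empty if `X` is not in `J`. -/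
def upperHoms : InjectiveAction I where
  obj X := Σ' h : X ∈ J, (mk x₀ ⟶ mk ⟨X, h⟩)
  -- Upward closure keeps the target in J, so this map is total.
  map {X Y} f g := ⟨hJ (leOfHom f) g.1,
    g.2 ≫ homMk (homOfLE (leOfHom f) : (⟨X, g.1⟩ : J) ⟶ ⟨Y, hJ (leOfHom f) g.1⟩)⟩
  map_id X a := by
    obtain ⟨h, g⟩ := a
    refine congrArg (PSigma.mk h) ?_
    change g ≫ homMk (𝟙 (⟨X, h⟩ : J)) = g
    simp
  map_comp {X Y Z} f f' a := by
    obtain ⟨h, g⟩ := a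
    refine congrArg (PSigma.mk (hJ (leOfHom (f ≫ f')) h)) ?_
    change g ≫ homMk ((homOfLE (leOfHom f) : (⟨X, h⟩ : J) ⟶ ⟨Y, hJ (leOfHom f) h⟩) ≫
      (homOfLE (leOfHom f') : _ ⟶ (⟨Z, hJ (leOfHom f') (hJ (leOfHom f) h)⟩ : J))) = _
    simp only [homMk, Functor.map_comp, Category.assoc]
  map_injective {X Y} f := by
    rintro ⟨h, g⟩ ⟨h', g'⟩ hg
    refine congrArg (PSigma.mk h) ?_
    exact (cancel_mono _).1 (eq_of_heq (PSigma.mk.inj hg).2)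

/-- A morphism of π₁(J) is a word in arrows and their inverses; the same word, read as a formal
expression, acts by right multiplication. -/
theorem exists_act_upperHoms {X Y : J} (g : mk X ⟶ mk Y) :
    ∃ t : InvTerm I X.1 Y.1, ∀ g₀ : mk x₀ ⟶ mk X,
      t.act (upperHoms hJ x₀) (⟨X.2, g₀⟩ : Σ' h : X.1 ∈ J, (mk x₀ ⟶ mk ⟨X.1, h⟩)) =
        some (⟨Y.2, g₀ ≫ g⟩ : Σ' h : Y.1 ∈ J, (mk x₀ ⟶ mk ⟨Y.1, h⟩)) := by
  induction g using FreeGroupoid.hom_induction with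
  | of f =>
    exact ⟨.of (homOfLE (leOfHom f)), fun g₀ => rfl⟩
  | inv f =>
    refine ⟨.inv (.of (homOfLE (leOfHom f))), fun g₀ => ?_⟩
    refine (PEquiv.eq_some_iff _).2 (congrArg some ?_)
    refine congrArg (PSigma.mk _) ?_
    change (g₀ ≫ Groupoid.inv (homMk f)) ≫ homMk f = g₀
    simp
  | comp g g' ih ih' =>
    obtain ⟨t, ht⟩ := ih
    obtain ⟨t', ht'⟩ := ih'
    refine ⟨t.comp t', fun g₀ => (PEquiv.trans_eq_some _ _ _ _).2 ⟨_, ht g₀, ?_⟩⟩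
    rw [← Category.assoc]
    exact ht' _

end UpperSet

theorem IsUpwardSimplyConnected.isSimplyConnectedCat {I : Type u} [PartialOrder I]
    (h : IsUpwardSimplyConnected I) {J : Set I} (hJ : IsUpperSet J) : IsSimplyConnectedCat J := by
  have key : ∀ (X : J) (g : FreeGroupoid.mk X ⟶ FreeGroupoid.mk X), g = 𝟙 _ := by
    intro X g
    obtain ⟨t, ht⟩ := exists_act_upperHoms hJ X g
    have hr : InvTerm.Rel (t.comp t) t :=
      _root_.Quotient.exact (h ⟨X⟩ (_root_.Quotient.mk _ t))
    have h2 := (PEquiv.trans_eq_some (t.act (upperHoms hJ X)) (t.act (upperHoms hJ X)) _ _).2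
      ⟨_, ht (𝟙 _), ht _⟩
    have h3 := h2.symm.trans ((congrArg (fun f : PEquiv _ _ => f _)
      (hr.act_eq (upperHoms hJ X))).trans (ht (𝟙 _)))
    have h4 := eq_of_heq (PSigma.mk.inj (Option.some.inj h3)).2
    have h5 : g ≫ g = g := by simpa using h4
    have h6 : g ≫ g = g ≫ 𝟙 _ := by rw [h5, Category.comp_id]
    exact (cancel_epi g).1 h6
  refine fun X Y => ⟨fun f g => ?_⟩
  have h1 : f ≫ Groupoid.inv g = 𝟙 _ := key X.as.as (f ≫ Groupoid.inv g)
  calc f = (f ≫ Groupoid.inv g) ≫ g := by simp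
    _ = g := by rw [h1, Category.id_comp]

/-! ### Detecting loops through a minimal point with values in ℤ/2 -/

section SimplyConnected

variable {P : Type u} [PartialOrder P]

open Classical in
/-- The functor to a group of order two which detects the arrows from a minimal element `p` to the
elements of `D`. -/
noncomputable def detect {p : P} (hp : ∀ x, x ≤ p → x = p) (D : Set P) (hpD : p ∉ D)
    (hD : ∀ y z, y ≠ p → p ≤ y → y ≤ z → (y ∈ D ↔ z ∈ D)) :
    P ⥤ SingleObj (Multiplicative (ZMod 2)) where
  obj _ := SingleObj.star _
  map {x y} _ := (if x = p ∧ y ∈ D then Multiplicative.ofAdd 1 else 1 : Multiplicative (ZMod 2))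
  map_id x := if_neg (by rintro ⟨rfl, h⟩; exact hpD h)
  map_comp {x y z} f g := by
    -- Composition in `SingleObj` multiplies in the reverse order.
    change (if x = p ∧ z ∈ D then Multiplicative.ofAdd 1 else 1 : Multiplicative (ZMod 2)) =
      (if y = p ∧ z ∈ D then Multiplicative.ofAdd 1 else 1) *
        if x = p ∧ y ∈ D then Multiplicative.ofAdd 1 else 1
    by_cases hx : x = p
    · subst hx
      by_cases hy : y = x
      · subst hy
        simp [hpD]
      · simp [hy, hD y z hy (leOfHom f) (leOfHom g)]
    · have hy : y ≠ p := by
        rintro rfl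
        exact hx (hp x (leOfHom f))
      simp [hx, hy]

/-- A zigzag from a to b in Q avoids p, so its image has trivial value under `detect`. Following `p
⟶ φ a` by it must equal `p ⟶ φ b`, so both arrows have the same value. -/
theorem IsSimplyConnectedCat.mem_of_mem (hP : IsSimplyConnectedCat P) {p : P}
    (hp : ∀ x, x ≤ p → x = p) (D : Set P) (hpD : p ∉ D)
    (hD : ∀ y z, y ≠ p → p ≤ y → y ≤ z → (y ∈ D ↔ z ∈ D))
    {Q : Type w} [PartialOrder Q] [IsPreconnected Q] {φ : Q → P} (hφ : Monotone φ)
    (hne : ∀ q, φ q ≠ p) {a b : Q} (ha : p ≤ φ a) (hb : p ≤ φ b) (h : φ a ∈ D) : φ b ∈ D := by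
  classical
  let Φ := detect hp D hpD hD
  have trivial_map : ∀ {x y : Q} (f : φ x ⟶ φ y), Φ.map f = 𝟙 _ := fun {x y} f =>
    if_neg fun h => hne x h.1
  have key : ∀ c : Q, Zigzag a c → ∃ m : FreeGroupoid.mk (φ a) ⟶ FreeGroupoid.mk (φ c),
      (FreeGroupoid.lift Φ).map m = 𝟙 _ := by
    intro c hc
    induction hc with
    | refl => exact ⟨𝟙 _, CategoryTheory.Functor.map_id _ _⟩
    | tail _ hcd ih =>
      obtain ⟨m, hm⟩ := ih
      rcases hcd with ⟨⟨f⟩⟩ | ⟨⟨f⟩⟩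
      · refine ⟨m ≫ FreeGroupoid.homMk (homOfLE (hφ (leOfHom f))), ?_⟩
        rw [Functor.map_comp, hm, FreeGroupoid.lift_map_homMk, trivial_map]
        exact Category.comp_id _
      · refine ⟨m ≫ inv (FreeGroupoid.homMk (homOfLE (hφ (leOfHom f)))), ?_⟩
        rw [Functor.map_comp, hm, Functor.map_inv]
        simp only [FreeGroupoid.lift_map_homMk, trivial_map]
        exact (Category.id_comp _).trans IsIso.inv_id
  obtain ⟨m, hm⟩ := key b (isPreconnected_zigzag a b)
  have heq := (hP (.mk p) (.mk (φ b))).elim (FreeGroupoid.homMk (homOfLE ha) ≫ m)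
    (FreeGroupoid.homMk (homOfLE hb))
  have := congrArg (FreeGroupoid.lift Φ).map heq
  rw [Functor.map_comp, hm, FreeGroupoid.lift_map_homMk, FreeGroupoid.lift_map_homMk] at this
  have h1 : Φ.map (homOfLE ha) = Φ.map (homOfLE hb) := (Category.comp_id _).symm.trans this
  have h2 : (if p = p ∧ φ a ∈ D then Multiplicative.ofAdd 1 else 1 : Multiplicative (ZMod 2)) =
    if p = p ∧ φ b ∈ D then Multiplicative.ofAdd 1 else 1 := h1
  by_contra hbD
  rw [if_pos ⟨rfl, h⟩, if_neg fun h => hbD h.2] at h2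
  exact one_ne_zero (α := ZMod 2) h2

end SimplyConnected

/-- Each `U k` is nonempty, so the new point is linked to every subtree. -/
theorem IsTreeLike.isPreconnected {P : Type u} [PartialOrder P] (hP : IsTreeLike P) :
    IsPreconnected P := by
  induction hP with
  | @adjoin n K _ U _ conn P _ e ih =>
    have main : ∀ s : AdjoinBelow _ (sigmaUpperSet U),
        Zigzag (e.symm .pt) (e.symm s) := by
      rintro (_ | ⟨k, x⟩)
      · exact .refl _
      · obtain ⟨u⟩ := (conn k).is_nonempty
        have hmono : Monotone fun y : K k => e.symm (.of ⟨k, y⟩) := fun y z hyz =>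
          e.symm.monotone (show AdjoinBelow.of _ ≤ AdjoinBelow.of _ from
            Sigma.mk_le_mk_iff.2 hyz)
        have := ih k
        have h1 : e.symm .pt ≤ e.symm (.of ⟨k, u.1⟩) := e.symm.monotone u.2
        exact (Zigzag.of_hom (homOfLE h1)).trans
          (zigzag_obj_of_zigzag hmono.functor (isPreconnected_zigzag u.1 x))
    refine zigzag_isPreconnected fun a b => ?_
    have ha := main (e a)
    have hb := main (e b)
    rw [e.symm_apply_apply] at ha hb
    exact ha.symm.trans hb

theorem IsTreeLike.of_orderIso {P Q : Type u} [PartialOrder P] [PartialOrder Q]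
    (hP : IsTreeLike P) (f : Q ≃o P) : IsTreeLike Q := by
  cases hP with
  | adjoin K U tree conn P e => exact .adjoin K U tree conn Q (f.trans e)

theorem IsForestLike.of_orderIso {P Q : Type u} [PartialOrder P] [PartialOrder Q]
    (hP : IsForestLike P) (f : Q ≃o P) : IsForestLike Q := by
  obtain ⟨n, K, _, hK, ⟨e⟩⟩ := hP
  exact ⟨n, K, _, hK, ⟨f.trans e⟩⟩

/-! ### Tree and forest decompositions as families of subsets -/

section Cover

variable {I : Type u} [PartialOrder I] {A : Set I} {ι : Type} [Finite ι] {S : ι → Set I}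

theorem isForestLike_of_cover (hA : ∀ x, x ∈ A ↔ ∃ i, x ∈ S i)
    (hS : ∀ i j x y, x ≤ y → x ∈ S i → y ∈ S j → i = j) (tree : ∀ i, IsTreeLike (S i)) :
    IsForestLike A := by
  obtain ⟨n, ⟨g⟩⟩ := Finite.exists_equiv_fin ι
  let f : (Σ k : Fin n, S (g.symm k)) ↪o A := OrderEmbedding.ofMapLEIff
    (fun s => ⟨s.2.1, (hA _).2 ⟨_, s.2.2⟩⟩) (by
      rintro ⟨k, x, hx⟩ ⟨l, y, hy⟩
      constructor
      · intro h
        obtain rfl := g.symm.injective (hS _ _ _ _ h hx hy)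
        exact Sigma.mk_le_mk_iff.2 h
      · rintro ⟨_, _, _, h⟩
        exact h)
  have hf : Function.Surjective f := by
    rintro ⟨x, hx⟩
    obtain ⟨i, hi⟩ := (hA x).1 hx
    obtain ⟨k, rfl⟩ := g.symm.surjective i
    exact ⟨⟨k, x, hi⟩, rfl⟩
  exact ⟨n, fun k => S (g.symm k), _, fun k => tree _, ⟨(RelIso.ofSurjective f hf).symm⟩⟩

theorem isTreeLike_of_cover {p : I} (hA : ∀ x, x ∈ A ↔ x = p ∨ ∃ i, x ∈ S i)
    (hp : ∀ i, ∀ x ∈ S i, ¬ x ≤ p)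
    (hS : ∀ i j x y, x ≤ y → x ∈ S i → y ∈ S j → i = j) (tree : ∀ i, IsTreeLike (S i))
    (conn : ∀ i, IsConnected {x : S i // p ≤ x.1}) : IsTreeLike A := by
  obtain ⟨n, ⟨g⟩⟩ := Finite.exists_equiv_fin ι
  let U (k : Fin n) : UpperSet (S (g.symm k)) :=
    { carrier := {x | p ≤ x.1}
      upper' := fun _ _ h h' => le_trans (α := I) h' h }
  let f₀ : AdjoinBelow (Σ k : Fin n, S (g.symm k)) (sigmaUpperSet U) → A
    | .pt => ⟨p, (hA _).2 (.inl rfl)⟩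
    | .of s => ⟨s.2.1, (hA _).2 (.inr ⟨_, s.2.2⟩)⟩
  let f : AdjoinBelow (Σ k : Fin n, S (g.symm k)) (sigmaUpperSet U) ↪o A :=
    OrderEmbedding.ofMapLEIff f₀ (by
      rintro (_ | ⟨k, x, hx⟩) (_ | ⟨l, y, hy⟩)
      · exact ⟨fun _ => le_refl _, fun _ => le_refl _⟩
      · exact Iff.rfl
      · exact ⟨fun h => (hp _ _ hx h).elim, fun h => h.elim⟩
      · constructor
        · intro h
          obtain rfl := g.symm.injective (hS _ _ _ _ h hx hy)
          exact Sigma.mk_le_mk_iff.2 h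
        · rintro ⟨_, _, _, h⟩
          exact h)
  have hf : Function.Surjective f := by
    rintro ⟨x, hx⟩
    obtain rfl | ⟨i, hi⟩ := (hA x).1 hx
    · exact ⟨.pt, rfl⟩
    · obtain ⟨k, rfl⟩ := g.symm.surjective i
      exact ⟨.of ⟨k, x, hi⟩, rfl⟩
  exact .adjoin (fun k => S (g.symm k)) U (fun k => tree _) (fun k => conn _) A
    (RelIso.ofSurjective f hf).symm

theorem IsForestLike.exists_cover (h : IsForestLike A) :
    ∃ (n : ℕ) (S : Fin n → Set I), (∀ x, x ∈ A ↔ ∃ i, x ∈ S i) ∧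
      (∀ i j x y, x ≤ y → x ∈ S i → y ∈ S j → i = j) ∧ ∀ i, IsTreeLike (S i) := by
  obtain ⟨n, K, _, hK, ⟨e⟩⟩ := h
  let ψ (k : Fin n) : K k ↪o I := OrderEmbedding.ofMapLEIff
    (fun x => (e.symm ⟨k, x⟩).1) fun x y => by simp
  refine ⟨n, fun k => Set.range (ψ k), ?_, ?_, fun k => (hK k).of_orderIso (ψ k).orderIso.symm⟩
  · intro x
    constructor
    · intro hx
      exact ⟨(e ⟨x, hx⟩).1, (e ⟨x, hx⟩).2, by simp [ψ]⟩
    · rintro ⟨i, y, rfl⟩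
      exact (e.symm ⟨i, y⟩).2
  · rintro i j _ _ h ⟨x, rfl⟩ ⟨y, rfl⟩
    have h' : e.symm ⟨i, x⟩ ≤ e.symm ⟨j, y⟩ := h
    exact (Sigma.le_def.1 (e.symm.le_iff_le.1 h')).fst

end Cover

/-! ### Removing a minimal point -/

section Removal

variable {I : Type u} [PartialOrder I] {A : Set I}

/-- Connectedness is tested on functions G constant along arrows: a fibre of G is closed under going
up and down above p, and `S k` is preconnected and avoids p, so `mem_of_mem` forces G to have a
single fibre. -/
theorem isConnected_above {p : I} (hpA : p ∈ A) (hp : ∀ x ∈ A, x ≤ p → x = p)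
    (hA : IsSimplyConnectedCat A) {n : ℕ} {S : Fin n → Set I}
    (hcover : ∀ x, x ∈ A \ {p} ↔ ∃ i, x ∈ S i)
    (hS : ∀ i j x y, x ≤ y → x ∈ S i → y ∈ S j → i = j) {k : Fin n} [IsPreconnected (S k)]
    (hk : ∃ x ∈ S k, p ≤ x) : IsConnected {x : S k // p ≤ x.1} := by
  obtain ⟨x, hx, hpx⟩ := hk
  have : Nonempty {x : S k // p ≤ x.1} := ⟨⟨⟨x, hx⟩, hpx⟩⟩
  have hmem : ∀ {i x}, x ∈ S i → x ∈ A ∧ x ≠ p := fun h => (hcover _).2 ⟨_, h⟩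
  have hsame : ∀ y z, y ∈ A → z ∈ A → y ≠ p → y ≤ z → (y ∈ S k ↔ z ∈ S k) := by
    intro y z hy hz hyp hyz
    have hzp : z ≠ p := by
      rintro rfl
      exact hyp (hp y hy hyz)
    obtain ⟨i, hi⟩ := (hcover y).1 ⟨hy, hyp⟩
    obtain ⟨j, hj⟩ := (hcover z).1 ⟨hz, hzp⟩
    obtain rfl := hS _ _ _ _ hyz hi hj
    constructor
    · intro h
      rwa [hS _ _ _ _ (le_refl y) h hi]
    · intro h
      rwa [hS _ _ _ _ (le_refl z) h hj]
  refine IsConnected.of_constant_of_preserves_morphisms fun {α} G hG a b => ?_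
  let D : Set A := {y | ∃ (h : y.1 ∈ S k) (h' : p ≤ y.1), G ⟨⟨y.1, h⟩, h'⟩ = G a}
  let φ : S k → A := fun x => ⟨x.1, (hmem x.2).1⟩
  have hφ : Monotone φ := fun _ _ h => h
  have hb : φ b.1 ∈ D := by
    refine hA.mem_of_mem (p := ⟨p, hpA⟩) (fun x hx => Subtype.ext (hp x.1 x.2 hx)) D
      (fun h => (hmem h.1).2 rfl) ?_ hφ (fun q h => (hmem q.2).2 (congrArg Subtype.val h))
      (a := a.1) a.2 b.2 ⟨a.1.2, a.2, rfl⟩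
    rintro ⟨y, hyA⟩ ⟨z, hzA⟩ hy hpy hyz
    have hyp : y ≠ p := fun h => hy (Subtype.ext h)
    have hpy' : p ≤ y := hpy
    have hyz' : y ≤ z := hyz
    have hkk := hsame y z hyA hzA hyp hyz'
    constructor
    · rintro ⟨h, h', hG'⟩
      refine ⟨hkk.1 h, hpy'.trans hyz', ?_⟩
      rw [← hG']
      exact (hG (homOfLE hyz)).symm
    · rintro ⟨h, h', hG'⟩
      refine ⟨hkk.2 h, hpy', ?_⟩
      rw [← hG']
      exact hG (homOfLE hyz)
  exact hb.2.2.symm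

theorem IsForestLike.of_remove_minimal {p : I} (hpA : p ∈ A) (hp : ∀ x ∈ A, x ≤ p → x = p)
    (hA : IsSimplyConnectedCat A) (h : IsForestLike ↥(A \ {p})) : IsForestLike A := by
  obtain ⟨n, S, hcover, hS, tree⟩ := h.exists_cover
  have hmem : ∀ {i x}, x ∈ S i → x ∈ A ∧ x ≠ p := fun h => (hcover _).2 ⟨_, h⟩
  -- T indexes the trees that p touches, E the others; B is the new tree formed by p and the trees
  -- in T.
  let T := {k : Fin n // ∃ x ∈ S k, p ≤ x}
  let E := {k : Fin n // ¬ ∃ x ∈ S k, p ≤ x}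
  let B : Set I := {x | x = p ∨ ∃ k : T, x ∈ S k.1}
  have hpS : ∀ {i x}, x ∈ S i → ¬ x ≤ p := fun h h' => (hmem h).2 (hp _ (hmem h).1 h')
  have hB : IsTreeLike B := by
    refine isTreeLike_of_cover (S := fun k : T => S k.1) (p := p) (fun _ => Iff.rfl)
      (fun _ _ => hpS) (fun i j x y h hi hj => Subtype.ext (hS _ _ _ _ h hi hj))
      (fun k => tree k.1) fun k => ?_
    have := (tree k.1).isPreconnected
    exact isConnected_above hpA hp hA hcover hS k.2
  refine isForestLike_of_cover (S := fun o : Option E => o.elim B fun k => S k.1) ?_ ?_ ?_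
  · intro x
    constructor
    · intro hx
      by_cases hxp : x = p
      · exact ⟨none, .inl hxp⟩
      · obtain ⟨k, hk⟩ := (hcover x).1 ⟨hx, hxp⟩
        by_cases hkT : ∃ x ∈ S k, p ≤ x
        · exact ⟨none, .inr ⟨⟨k, hkT⟩, hk⟩⟩
        · exact ⟨some ⟨k, hkT⟩, hk⟩
    · rintro ⟨_ | k, h⟩
      · rcases h with rfl | ⟨k, hk⟩
        · exact hpA
        · exact (hmem hk).1
      · exact (hmem h).1
  · rintro (_ | k) (_ | l) x y hxy hx hy
    · rfl
    · rcases hx with rfl | ⟨k, hk⟩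
      · exact (l.2 ⟨y, hy, hxy⟩).elim
      · exact (l.2 (hS _ _ _ _ hxy hk hy ▸ k.2)).elim
    · rcases hy with rfl | ⟨l, hl⟩
      · exact (hpS hx hxy).elim
      · exact (k.2 (hS _ _ _ _ hxy hx hl ▸ l.2)).elim
    · exact congrArg some (Subtype.ext (hS _ _ _ _ hxy hx hy))
  · rintro (_ | k)
    · exact hB
    · exact tree k.1

/-- Stated for all upper sets because deleting a minimal point leaves an upper set, which permits
induction on cardinality. -/
theorem isForestLike_of_isSimplyConnectedCat [Finite I]
    (h : ∀ J : Set I, IsUpperSet J → IsSimplyConnectedCat J) {A : Set I} (hA : IsUpperSet A) :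
    IsForestLike A := by
  obtain ⟨m, hm⟩ : ∃ m, A.ncard = m := ⟨_, rfl⟩
  induction m generalizing A with
  | zero =>
    rw [Set.ncard_eq_zero] at hm
    subst hm
    exact isForestLike_of_cover (S := fun i : Empty => i.elim) (by simp) (fun i => i.elim)
      fun i => i.elim
  | succ m ih =>
    obtain ⟨p, hp⟩ := A.toFinite.exists_minimal (Set.nonempty_of_ncard_ne_zero (by omega))
    refine .of_remove_minimal hp.1 (fun x hx hxp => le_antisymm hxp (hp.2 hx hxp)) (h A hA)
      (ih ?_ ?_)
    · intro x y hxy hx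
      refine ⟨hA hxy hx.1, ?_⟩
      rintro rfl
      exact hx.2 (le_antisymm hxy (hp.2 hx.1 hxy))
    · rw [Set.ncard_sdiff_singleton_of_mem hp.1, hm]
      rfl

end Removal

theorem corollary4p7 (I : Type u) [PartialOrder I] [Finite I] :
    (IsUpwardSimplyConnected I ↔ ∀ J : Set I, IsUpperSet J → IsSimplyConnectedCat J) ∧
    ((∀ J : Set I, IsUpperSet J → IsSimplyConnectedCat J) ↔ IsForestLike I) := by
  have h₁ : IsUpwardSimplyConnected I → ∀ J : Set I, IsUpperSet J → IsSimplyConnectedCat J :=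
    fun h _ hJ => h.isSimplyConnectedCat hJ
  have h₂ : (∀ J : Set I, IsUpperSet J → IsSimplyConnectedCat J) → IsForestLike I := fun h =>
    (isForestLike_of_isSimplyConnectedCat h isUpperSet_univ).of_orderIso
      OrderIso.Set.univ.symm
  have h₃ : IsForestLike I → IsUpwardSimplyConnected I := IsForestLike.isUpwardSimplyConnected
  exact ⟨⟨h₁, fun h => h₃ (h₂ h)⟩, ⟨h₂, fun h => h₁ (h₃ h)⟩⟩
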